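/- Call a measurable function $\phi:\mathbb{R}\to[-1,1]$ sigmoidal if $\phi(z)\to-1$ as $z\to-\infty$ and $\phi(z)\to1$ as $z\to\infty$. Fix such a $\phi$ and, for $k\ge1$, let $\mathcal{H}_k^\phi$ be the set of all functions $h:\mathbb{R}^d\to\mathbb{R}$ of the form $h(x)=c_0+\sum_{l=1}^k c_l\,\phi(a_l\cdot x+b_l)$ with $a_l\in\mathbb{R}^d$ and $b_l,c_l\in\mathbb{R}$. For random variables $X\in\mathbb{R}^d$, $Y\in\mathbb{R}$, let $\mathrm{mmse}(Y|X)=\inf_h\mathbb{E}[(Y-h(X))^2]$, where the infimum is over all Borel functions $h:\mathbb{R}^d\to\mathbb{R}$; and for independent copies $(X_1,Y_1),\dots,(X_n,Y_n)$ of $(X,Y)$, let $\mathrm{mmse}_{k,n}(Y|X)=\inf_{h\in\mathcal{H}_k^\phi}\frac1n\sum_{i=1}^n(Y_i-h(X_i))^2$. Let $B\subset\mathbb{R}^d$ be a bounded set containing $0$. Let $\Gamma_B$ be the set of functions $h:B\to\mathbb{R}$ for which there is a complex-valued measure $\hat H$ on $\mathbb{R}^d$ (possibly of infinite total mass) with $\int|\omega|\,|\hat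 H|(d\omega)<\infty$ and $$h(x)=h(0)+\int_{\mathbb{R}^d}\left(e^{\mathrm{i}\omega\cdot x}-1\right)\hat H(d\omega)\qquad\text{for all }x\in B,$$ and let the Barron constant $C_h$ be the infimum of $\int\sup_{x\in B}|\omega\cdot x|\,|\hat H|(d\omega)$ over all such $\hat H$. Theorem. Let $k,n\ge1$ be integers and $0<\delta\le1$. Suppose that $Y\in[-1,1]$ and $X\in B$ almost surely, and that the conditional expectation $\eta(x)=\mathbb{E}[Y|X=x]$ (some version of it on $B$) belongs to $\Gamma_B$. Then, with probability at least $1-\delta$, $$\mathrm{mmse}_{k,n}(Y|X)-\epsilon_{k,n,\delta}\le\mathrm{mmse}(Y|X),$$ where $$\epsilon_{k,n,\delta}=2(1+C_\eta)^2\sqrt{\frac{2\log(1/\delta)}{n}}+\frac{4C_\eta^2}{k}+\frac{8C_\eta}{\sqrt k}.$$ -/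

import Mathlib

open MeasureTheory ProbabilityTheory Filter Topology

noncomputable section

namespace NNMMSE

/-- Euclidean space `ℝ^d`. -/
abbrev E (d : ℕ) : Type := EuclideanSpace ℝ (Fin d)

/-- A sigmoidal function: measurable, with values in `[-1, 1]`, tending to `-1` at `-∞` and to `1`
at `+∞`. -/
structure IsSigmoidal (φ : ℝ → ℝ) : Prop where
  measurable : Measurable φ
  mem_Icc : ∀ z, φ z ∈ Set.Icc (-1 : ℝ) 1
  tendsto_atBot : Tendsto φ atBot (𝓝 (-1))
  tendsto_atTop : Tendsto φ atTop (𝓝 1)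

/-- The class of two-layer neural networks of size `k` with activation function `φ`: all functions
`x ↦ c₀ + ∑ l, c l * φ (a l ⬝ x + b l)` with `k` hidden units. -/
def twoLayer (d : ℕ) (φ : ℝ → ℝ) (k : ℕ) : Set (E d → ℝ) :=
  {h | ∃ (c₀ : ℝ) (c b : Fin k → ℝ) (a : Fin k → E d),
    ∀ x, h x = c₀ + ∑ l, c l * φ (inner ℝ (a l) x + b l)}

/-- The empirical square loss of `h` on the data `(x i, y i)`, `i = 1, …, n`. -/
def empLoss {d n : ℕ} (x : Fin n → E d) (y : Fin n → ℝ) (h : E d → ℝ) : ℝ :=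
  (1 / (n : ℝ)) * ∑ i, (y i - h (x i)) ^ 2

/-- The estimator `mmse_{k,n}(Y | X)` evaluated on the data `(x i, y i)`, `i = 1, …, n`: the
infimum of the empirical square loss over the two-layer networks of size `k`. -/
def mmseEmp {d n : ℕ} (φ : ℝ → ℝ) (k : ℕ) (x : Fin n → E d) (y : Fin n → ℝ) : ℝ :=
  ⨅ h : twoLayer d φ k, empLoss x y h

/-- `mmse(Y | X)`: the infimum of `𝔼[(Y - h(X))²]` over all Borel functions `h : ℝ^d → ℝ`. The
expectations of these nonnegative variables are taken in `[0, ∞]`. -/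
def mmse {Ω : Type*} [MeasurableSpace Ω] {d : ℕ} (P : Measure Ω) (X : Ω → E d) (Y : Ω → ℝ) : ℝ :=
  (⨅ h : {h : E d → ℝ // Measurable h},
    ∫⁻ w, ENNReal.ofReal ((Y w - h.1 (X w)) ^ 2) ∂P).toReal

/-- The complex-valued measure `Ĥ` on `ℝ^d` with polar decomposition `dĤ = u d|Ĥ|`, `|Ĥ| = ν`,
`|u| = 1`, has `∫ |ω| |Ĥ|(dω) < ∞` and represents the function `h` on `B`:
`h x = h 0 + ∫ (exp (i ω ⬝ x) - 1) Ĥ(dω)` for all `x ∈ B`.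

By the polar decomposition, every (finite) complex measure `Ĥ` is of this form with `ν` finite, and
conversely. Only the first moment of `|Ĥ|` is required to be finite, so measures with
infinite mass near `0`, such as `Ĥ(dω) = (iω)⁻¹ g(ω) dω` with `g` integrable, are included; the
integral converges absolutely since `|exp (i ω ⬝ x) - 1| ≤ |ω| |x|`. Only the values of `h` on `B`
matter when `0 ∈ B`. -/
structure IsBarronRep {d : ℕ} (B : Set (E d)) (h : E d → ℝ) (ν : Measure (E d)) (u : E d → ℂ) :
    Prop where
  measurable_phase : Measurable u
  norm_phase : ∀ ω, ‖u ω‖ = 1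
  moment : ∫⁻ ω, ENNReal.ofReal ‖ω‖ ∂ν < ⊤
  repr : ∀ x ∈ B, (h x : ℂ) =
    (h 0 : ℂ) + ∫ ω, (Complex.exp (Complex.I * ((inner ℝ ω x : ℝ) : ℂ)) - 1) * u ω ∂ν

/-- Barron's class `Γ_B`. -/
def barronClass {d : ℕ} (B : Set (E d)) : Set (E d → ℝ) :=
  {h | ∃ (ν : Measure (E d)) (u : E d → ℂ), IsBarronRep B h ν u}

/-- `|ω|_B = sup_{x ∈ B} |ω ⬝ x|`. -/
def supNorm {d : ℕ} (B : Set (E d)) (ω : E d) : ℝ :=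
  ⨆ x : B, |(inner ℝ ω (x : E d) : ℝ)|

/-- The Barron constant `C_h`: the infimum of `∫ |ω|_B |Ĥ|(dω)` over all the complex-valued measures
`Ĥ` that represent `h` on `B`. -/
def barronConst {d : ℕ} (B : Set (E d)) (h : E d → ℝ) : ℝ :=
  sInf {C | ∃ (ν : Measure (E d)) (u : E d → ℂ), IsBarronRep B h ν u ∧ C = ∫ ω, supNorm B ω ∂ν}

/-- The error term
`ε_{k,n,δ} = 2 (1 + C)² √(2 log (1/δ) / n) + 4 C² / k + 8 C / √k`. -/
def epsErr (C : ℝ) (k n : ℕ) (δ : ℝ) : ℝ :=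
  2 * (1 + C) ^ 2 * √(2 * Real.log (1 / δ) / n) + 4 * C ^ 2 / k + 8 * C / √(k : ℝ)

end NNMMSE

end

/-!
The empirical risk of one fixed network bounds `mmse_{k,n}` from above, so it suffices to exhibit, for
each `D > C_η`, a network `h` of size `k` with `𝔼[(η(X) - h(X))²] ≤ 4 D² / k` and `|Y - h(X)| ≤ 2 (1 + D)`.
Its risk exceeds `mmse` by at most `4 D² / k`, because `η(X) = 𝔼[Y | X]` is an orthogonal projection
(`integral_sq_sub_eq_add`, `integral_sq_sub_condExp_le_mmse`), and its empirical risk exceeds its risk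
by at most `2 (1 + D)² √(2 log (1/δ) / n)` outside an event of probability `δ`, by Hoeffding's inequality
(`ofReal_one_sub_le_measure_mean_le`). Since `C_η` is an infimum that need not be attained, `D` then
decreases to `C_η` along a sequence, and the limsup of the good events still has probability at least
`1 - δ` (`le_measure_limsup_of_le`). The Pythagorean identity makes the term `8 C / √k` of the error
superfluous.

The network comes from Barron's theorem (`exists_twoLayer_integral_sq_le`). For fixed `ω`, the function
`x ↦ Re ((exp (i ω ⬝ x) - 1) u)` depends only on `z = ω ⬝ x / |ω|_B ∈ [-1, 1]`, and a `C¹` function `F` on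
`[-1, 1]` is `(F(1) + F(-1)) / 2 + ½ ∫ F'(t) sgn(z - t) dt`. Integrating over `ω` represents `η` on `B` as
a constant plus an integral of steps against a finite measure, with total weight at most
`∫ |ω|_B |Ĥ|(dω)` (`integral_stepWeight_mul_step`). The steps are replaced by steep sigmoids *before*
sampling: the units converge for almost every location `t` of the jump, so dominated convergence
applies and the atoms of the law of `X` play no role (`tendsto_integral_sigmoidUnit`). Finally, Maurey's
averaging argument replaces the integral by `k` units (`exists_sum_sub_integral_sq_le`).
-/

namespace NNMMSE

/-! ### The seminorm `|ω|_B` and the Barron constant -/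

variable {d : ℕ} {B : Set (E d)}

lemma bddAbove_range_abs_inner (hB : Bornology.IsBounded B) (ω : E d) :
    BddAbove (Set.range fun x : B => |(inner ℝ ω (x : E d) : ℝ)|) := by
  obtain ⟨R, hR⟩ := hB.exists_norm_le
  refine ⟨‖ω‖ * R, ?_⟩
  rintro _ ⟨x, rfl⟩
  exact (abs_real_inner_le_norm ω x).trans
    (mul_le_mul_of_nonneg_left (hR x x.2) (norm_nonneg ω))

lemma supNorm_nonneg (B : Set (E d)) (ω : E d) : 0 ≤ supNorm B ω :=
  Real.iSup_nonneg fun _ => abs_nonneg _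

lemma abs_inner_le_supNorm (hB : Bornology.IsBounded B) (ω : E d) {x : E d} (hx : x ∈ B) :
    |(inner ℝ ω x : ℝ)| ≤ supNorm B ω :=
  le_ciSup (bddAbove_range_abs_inner hB ω) (⟨x, hx⟩ : B)

lemma measurable_supNorm (hB : Bornology.IsBounded B) : Measurable (supNorm B) :=
  (lowerSemicontinuous_ciSup (bddAbove_range_abs_inner hB) fun x : B =>
    Continuous.lowerSemicontinuous (by fun_prop)).measurable

lemma integrable_supNorm (hB : Bornology.IsBounded B) {ν : Measure (E d)}
    (hν : ∫⁻ ω, ENNReal.ofReal ‖ω‖ ∂ν < ⊤) : Integrable (supNorm B) ν := by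
  obtain ⟨R, hR0, hR⟩ := hB.exists_pos_norm_le
  have hnorm : Integrable (fun ω : E d => ‖ω‖) ν :=
    ⟨by fun_prop, by simpa [HasFiniteIntegral, ← ofReal_norm] using hν⟩
  refine (hnorm.const_mul R).mono' (measurable_supNorm hB).aestronglyMeasurable
    (ae_of_all _ fun ω => ?_)
  rw [Real.norm_of_nonneg (supNorm_nonneg B ω)]
  refine Real.iSup_le (fun x => ?_) (by positivity)
  rw [mul_comm]
  exact (abs_real_inner_le_norm ω x).trans
    (mul_le_mul_of_nonneg_left (hR x x.2) (norm_nonneg ω))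

lemma barronConst_nonneg (B : Set (E d)) (h : E d → ℝ) : 0 ≤ barronConst B h := by
  refine Real.sInf_nonneg ?_
  rintro _ ⟨ν, u, -, rfl⟩
  exact integral_nonneg (supNorm_nonneg B)

lemma exists_isBarronRep_lt {h : E d → ℝ} (hh : h ∈ barronClass B) {D : ℝ}
    (hD : barronConst B h < D) :
    ∃ (ν : Measure (E d)) (u : E d → ℂ), IsBarronRep B h ν u ∧ ∫ ω, supNorm B ω ∂ν < D := by
  obtain ⟨ν, u, hνu⟩ := hh
  obtain ⟨_, ⟨ν', u', h', rfl⟩, hlt⟩ :=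
    exists_lt_of_csInf_lt (s := {C | ∃ (ν : Measure (E d)) (u : E d → ℂ),
      IsBarronRep B h ν u ∧ C = ∫ ω, supNorm B ω ∂ν}) ⟨_, ν, u, hνu, rfl⟩ hD
  exact ⟨ν', u', h', hlt⟩

/-- `ridgeSlope s u t = Re (i u exp (i s t))`; `s` times it is the derivative of the ridge profile
`t ↦ Re ((exp (i s t) - 1) u)`. -/
noncomputable def ridgeSlope (s : ℝ) (u : ℂ) (t : ℝ) : ℝ :=
  (Complex.I * u * Complex.exp (Complex.I * ((s * t : ℝ) : ℂ))).re

lemma abs_ridgeSlope_le (s : ℝ) {u : ℂ} (hu : ‖u‖ = 1) (t : ℝ) : |ridgeSlope s u t| ≤ 1 := by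
  refine (Complex.abs_re_le_norm _).trans ?_
  rw [norm_mul, norm_mul, hu, mul_comm Complex.I ((s * t : ℝ) : ℂ), Complex.norm_exp_ofReal_mul_I]
  simp

lemma hasDerivAt_ridge (s : ℝ) (u : ℂ) (t : ℝ) :
    HasDerivAt (fun t : ℝ => ((Complex.exp (Complex.I * ((s * t : ℝ) : ℂ)) - 1) * u).re)
      (s * ridgeSlope s u t) t := by
  have h1 : HasDerivAt (fun t : ℝ => Complex.I * ((s * t : ℝ) : ℂ)) (Complex.I * (s : ℂ)) t := by
    have := ((hasDerivAt_id t).const_mul s).ofReal_comp.const_mul Complex.I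
    simpa using this
  have h2 := ((h1.cexp.sub_const 1).mul_const u)
  have h3 := Complex.reCLM.hasFDerivAt.comp_hasDerivAt t h2
  refine h3.congr_deriv ?_
  rw [ridgeSlope, ← Complex.re_ofReal_mul, Complex.reCLM_apply]
  congr 1
  ring

/-- Reconstruction of the ridge profile on `[-1, 1]` from jumps of height `2`: this is the
fundamental theorem of calculus on `[-1, z]` and on `[z, 1]`, the two parts subtracted. -/
lemma integral_ridgeSlope_mul_step (s : ℝ) (u : ℂ) {z : ℝ} (hz : |z| ≤ 1) :
    s * ∫ t in Set.Ioc (-1 : ℝ) 1, ridgeSlope s u t * (if t < z then 1 else -1) =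
      2 * ((Complex.exp (Complex.I * ((s * z : ℝ) : ℂ)) - 1) * u).re
        - ((Complex.exp (Complex.I * ((s * 1 : ℝ) : ℂ)) - 1) * u).re
        - ((Complex.exp (Complex.I * ((s * (-1) : ℝ) : ℂ)) - 1) * u).re := by
  obtain ⟨hz1, hz2⟩ := abs_le.1 hz
  have hcont : Continuous (fun t => s * ridgeSlope s u t) := by unfold ridgeSlope; fun_prop
  have ftc (a b : ℝ) := intervalIntegral.integral_eq_sub_of_hasDerivAt
    (fun t _ => hasDerivAt_ridge s u t) (hcont.intervalIntegrable a b)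
  have hl : ∫ t in Set.Ioc (-1) z, s * (ridgeSlope s u t * (if t < z then 1 else -1)) =
      ∫ t in Set.Ioc (-1) z, s * ridgeSlope s u t := by
    rw [integral_Ioc_eq_integral_Ioo, integral_Ioc_eq_integral_Ioo]
    refine setIntegral_congr_fun measurableSet_Ioo fun t ht => ?_
    simp [ht.2]
  have hr : ∫ t in Set.Ioc z 1, s * (ridgeSlope s u t * (if t < z then 1 else -1)) =
      -∫ t in Set.Ioc z 1, s * ridgeSlope s u t := by
    rw [← integral_neg]
    refine setIntegral_congr_fun measurableSet_Ioc fun t ht => ?_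
    simp [ht.1.le]
  have hint : IntegrableOn (fun t => s * (ridgeSlope s u t * (if t < z then 1 else -1)))
      (Set.Ioc (-1) 1) := by
    refine Integrable.mono (hcont.integrableOn_Ioc) ?_ (ae_of_all _ fun t => ?_)
    · refine Measurable.aestronglyMeasurable ?_
      have hm : Measurable (ridgeSlope s u) := by unfold ridgeSlope; fun_prop
      exact ((hm.mul (Measurable.ite measurableSet_Iio measurable_const measurable_const)).const_mul s)
    · split_ifs <;> simp
  rw [← integral_const_mul, ← Set.Ioc_union_Ioc_eq_Ioc hz1 hz2,
    setIntegral_union (Set.Ioc_disjoint_Ioc_of_le le_rfl) measurableSet_Ioc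
      (hint.mono_set (Set.Ioc_subset_Ioc_right hz2)) (hint.mono_set (Set.Ioc_subset_Ioc_left hz1)),
    hl, hr, ← intervalIntegral.integral_of_le hz1, ← intervalIntegral.integral_of_le hz2, ftc, ftc]
  ring

/-! ### Maurey's lemma -/

section Maurey

variable {Ω Θ : Type*} [MeasurableSpace Ω] [MeasurableSpace Θ]

lemma integrable_of_abs_le {P : Measure Ω} [IsFiniteMeasure P] {f : Ω → ℝ} (hf : Measurable f)
    {K : ℝ} (hK : ∀ w, |f w| ≤ K) : Integrable f P :=
  Integrable.of_bound hf.aestronglyMeasurable K (ae_of_all _ hK)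

lemma abs_integral_le_of_abs_le (ρ : Measure Θ) [IsProbabilityMeasure ρ] {f : Θ → ℝ}
    {D : ℝ} (hD : ∀ θ, |f θ| ≤ D) : |∫ θ, f θ ∂ρ| ≤ D := by
  simpa using norm_integral_le_of_norm_le_const (μ := ρ) (f := f) (ae_of_all _ hD)

/-- The shift by `s` does not interact with the fluctuation of `f` around its mean. -/
lemma integral_sq_add_sub_mean_le (ρ : Measure Θ) [IsProbabilityMeasure ρ] {f : Θ → ℝ}
    (hf : Measurable f) {D : ℝ} (hD : ∀ θ, |f θ| ≤ D) (s : ℝ) :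
    ∫ θ, (s + (f θ - ∫ θ', f θ' ∂ρ)) ^ 2 ∂ρ ≤ s ^ 2 + D ^ 2 := by
  set m := ∫ θ', f θ' ∂ρ with hm
  have hfi : Integrable f ρ := integrable_of_abs_le hf hD
  have hsq (θ : Θ) : f θ ^ 2 ≤ D ^ 2 := sq_le_sq' (abs_le.1 (hD θ)).1 (abs_le.1 (hD θ)).2
  have hf2 : Integrable (fun θ => f θ ^ 2) ρ :=
    integrable_of_abs_le (hf.pow_const 2) fun θ => by rw [abs_of_nonneg (sq_nonneg _)]; exact hsq θ
  have h2 : ∫ θ, f θ ^ 2 ∂ρ ≤ D ^ 2 := by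
    simpa using integral_mono hf2 (integrable_const (D ^ 2)) hsq
  have heq : ∀ θ, (s + (f θ - m)) ^ 2 = (s - m) ^ 2 + 2 * (s - m) * f θ + f θ ^ 2 :=
    fun θ => by ring
  simp_rw [heq]
  have hlin : Integrable (fun θ => (s - m) ^ 2 + 2 * (s - m) * f θ) ρ :=
    (integrable_const _).add (hfi.const_mul _)
  rw [integral_add hlin hf2, integral_add (integrable_const _) (hfi.const_mul _),
    integral_const_mul, ← hm]
  simp only [integral_const, probReal_univ, one_smul]
  nlinarith [sq_nonneg m]

/-- **Maurey's lemma**, in the form of an averaging argument. The terms are chosen one at a time: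
averaged over the next one, the squared norm of the accumulated deviation grows by at most `D ^ 2`,
hence so it does for some choice. -/
lemma exists_sum_sub_mean_sq_le (P : Measure Ω) [IsProbabilityMeasure P]
    (ρ : Measure Θ) [IsProbabilityMeasure ρ] {g : Θ → Ω → ℝ}
    (hg : Measurable fun q : Θ × Ω => g q.1 q.2) {D : ℝ} (hD : ∀ θ w, |g θ w| ≤ D) (k : ℕ) :
    ∃ θ : Fin k → Θ, ∫ w, (∑ i, (g (θ i) w - ∫ θ', g θ' w ∂ρ)) ^ 2 ∂P ≤ k * D ^ 2 := by
  have hmean : Measurable fun w => ∫ θ', g θ' w ∂ρ :=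
    (StronglyMeasurable.integral_prod_left' hg.stronglyMeasurable).measurable
  have hgm (θ : Θ) : Measurable (g θ) := hg.comp measurable_prodMk_left
  have hdev (θ : Θ) (w : Ω) : |g θ w - ∫ θ', g θ' w ∂ρ| ≤ 2 * D := by
    refine (abs_sub _ _).trans ?_
    linarith [hD θ w, abs_integral_le_of_abs_le ρ (fun θ => hD θ w)]
  induction k with
  | zero => exact ⟨Fin.elim0, by simp⟩
  | succ k ih =>
    obtain ⟨θ, hθ⟩ := ih
    set S : Ω → ℝ := fun w => ∑ i, (g (θ i) w - ∫ θ', g θ' w ∂ρ) with hS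
    have hSm : Measurable S := Finset.measurable_fun_sum _ fun i _ => (hgm _).sub hmean
    have hSb (w : Ω) : |S w| ≤ k * (2 * D) := by
      refine (Finset.abs_sum_le_sum_abs _ _).trans ?_
      simpa using Finset.sum_le_sum fun i (_ : i ∈ Finset.univ) => hdev (θ i) w
    have hb (w : Ω) (θ : Θ) :
        |(S w + (g θ w - ∫ θ', g θ' w ∂ρ)) ^ 2| ≤ (k * (2 * D) + 2 * D) ^ 2 := by
      rw [abs_pow]
      gcongr
      exact (abs_add_le _ _).trans (add_le_add (hSb w) (hdev θ w))
    have hjm : Measurable fun p : Θ × Ω => (S p.2 + (g p.1 p.2 - ∫ θ', g θ' p.2 ∂ρ)) ^ 2 :=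
      ((hSm.comp measurable_snd).add (hg.sub (hmean.comp measurable_snd))).pow_const 2
    have hji : Integrable (fun p : Θ × Ω => (S p.2 + (g p.1 p.2 - ∫ θ', g θ' p.2 ∂ρ)) ^ 2)
        (ρ.prod P) := integrable_of_abs_le hjm fun p => hb p.2 p.1
    obtain ⟨θ₀, hθ₀⟩ := exists_le_integral hji.integral_prod_left
    have hSi : Integrable (fun w => S w ^ 2) P :=
      integrable_of_abs_le (hSm.pow_const 2) (K := (k * (2 * D)) ^ 2) fun w => by
        rw [abs_pow]; gcongr; exact hSb w
    refine ⟨Fin.snoc θ θ₀, ?_⟩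
    simp only [Fin.sum_univ_castSucc, Fin.snoc_castSucc, Fin.snoc_last]
    calc ∫ w, (S w + (g θ₀ w - ∫ θ', g θ' w ∂ρ)) ^ 2 ∂P
        ≤ ∫ θ, ∫ w, (S w + (g θ w - ∫ θ', g θ' w ∂ρ)) ^ 2 ∂P ∂ρ := hθ₀
      _ = ∫ w, ∫ θ, (S w + (g θ w - ∫ θ', g θ' w ∂ρ)) ^ 2 ∂ρ ∂P := integral_integral_swap hji
      _ ≤ ∫ w, (S w ^ 2 + D ^ 2) ∂P :=
          integral_mono hji.integral_prod_right (hSi.add (integrable_const _)) fun w =>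
            integral_sq_add_sub_mean_le ρ (hg.comp measurable_prodMk_right) (fun θ => hD θ w) (S w)
      _ = ∫ w, S w ^ 2 ∂P + D ^ 2 := by
          rw [integral_add hSi (integrable_const _)]; simp
      _ ≤ ((k + 1 : ℕ) : ℝ) * D ^ 2 := by push_cast; linarith

/-- Maurey's lemma for a finite measure `M`: `∫ G θ dM(θ)` is approximated in mean square by `k`
terms `G θ` of equal weight. -/
lemma exists_sum_sub_integral_sq_le [Nonempty Θ] (P : Measure Ω) [IsProbabilityMeasure P]
    (M : Measure Θ) [IsFiniteMeasure M] {G : Θ → Ω → ℝ}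
    (hG : Measurable fun q : Θ × Ω => G q.1 q.2) {K : ℝ} (hK : ∀ θ w, |G θ w| ≤ K) {k : ℕ}
    (hk : 0 < k) :
    ∃ θ : Fin k → Θ, ∫ w, (∑ i, M.real Set.univ / k * G (θ i) w - ∫ θ', G θ' w ∂M) ^ 2 ∂P
      ≤ (M.real Set.univ * K) ^ 2 / k := by
  have hk' : (0 : ℝ) < k := Nat.cast_pos.2 hk
  -- `M = 0` cannot be normalized to a probability measure
  rcases eq_zero_or_neZero M with rfl | hM
  · exact ⟨fun _ => Classical.arbitrary Θ, by simp⟩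
  set m := M.real Set.univ with hm
  have hm0 : 0 < m := by
    rw [hm, Measure.real, ENNReal.toReal_pos_iff]
    exact ⟨Measure.measure_univ_pos.2 hM.out, measure_lt_top _ _⟩
  obtain ⟨θ, hθ⟩ := exists_sum_sub_mean_sq_le P ((M Set.univ)⁻¹ • M)
    (g := fun θ w => m * G θ w) (hG.const_mul m) (D := m * K)
    (fun θ w => by rw [abs_mul, abs_of_pos hm0]; gcongr; exact hK θ w) k
  refine ⟨θ, ?_⟩
  have hmean (w : Ω) : ∫ θ', m * G θ' w ∂((M Set.univ)⁻¹ • M) = ∫ θ', G θ' w ∂M := by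
    rw [integral_smul_measure, integral_const_mul, ENNReal.toReal_inv, ← Measure.real, ← hm,
      smul_eq_mul, inv_mul_cancel_left₀ hm0.ne']
  have heq (w : Ω) : (∑ i, m / k * G (θ i) w - ∫ θ', G θ' w ∂M) ^ 2 =
      (k ^ 2 : ℝ)⁻¹ * (∑ i, (m * G (θ i) w - ∫ θ', G θ' w ∂M)) ^ 2 := by
    rw [Finset.sum_sub_distrib, Finset.sum_const, Finset.card_univ, Fintype.card_fin,
      nsmul_eq_mul, ← Finset.mul_sum, ← Finset.mul_sum]
    field_simp
  simp_rw [hmean] at hθ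
  simp_rw [heq]
  rw [integral_const_mul]
  calc _ ≤ (k ^ 2 : ℝ)⁻¹ * (k * (m * K) ^ 2) := by gcongr
    _ = (m * K) ^ 2 / k := by field_simp

end Maurey

/-! ### Barron's approximation theorem -/

/-- The measure `|ω|_B |Ĥ|(dω) dt` on the parameters `(ω, t)` of the ridge steps, where the jump
location `t` ranges over `(-1, 1]`. It is finite, even though `|Ĥ|` itself need not be σ-finite. -/
noncomputable def stepMeasure (B : Set (E d)) (ν : Measure (E d)) : Measure (E d × ℝ) :=
  (ν.withDensity fun ω => ENNReal.ofReal (supNorm B ω)).prod (volume.restrict (Set.Ioc (-1) 1))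

/-- The density of the ridge steps with respect to `stepMeasure`. -/
noncomputable def stepWeight (B : Set (E d)) (u : E d → ℂ) (p : E d × ℝ) : ℝ :=
  1 / 2 * ridgeSlope (supNorm B p.1) (u p.1) p.2

/-- The normalized projection `ω ⬝ x / |ω|_B`, which lies in `[-1, 1]` for `x ∈ B`. (It is `0` when
`|ω|_B = 0`.) -/
noncomputable def ridgeCoord (B : Set (E d)) (ω x : E d) : ℝ := inner ℝ ω x / supNorm B ω

lemma abs_ridgeCoord_le (hB : Bornology.IsBounded B) (ω : E d) {x : E d} (hx : x ∈ B) :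
    |ridgeCoord B ω x| ≤ 1 := by
  rw [ridgeCoord, abs_div, abs_of_nonneg (supNorm_nonneg B ω)]
  exact div_le_one_of_le₀ (abs_inner_le_supNorm hB ω hx) (supNorm_nonneg B ω)

lemma supNorm_mul_ridgeCoord (hB : Bornology.IsBounded B) (ω : E d) {x : E d} (hx : x ∈ B) :
    supNorm B ω * ridgeCoord B ω x = inner ℝ ω x := by
  rcases eq_or_ne (supNorm B ω) 0 with h | h
  · have := abs_inner_le_supNorm hB ω hx
    rw [h, abs_nonpos_iff] at this
    rw [h, this, zero_mul]
  · exact mul_div_cancel₀ _ h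

lemma measurable_ridgeCoord (hB : Bornology.IsBounded B) :
    Measurable fun p : E d × E d => ridgeCoord B p.1 p.2 := by
  have := measurable_supNorm hB
  unfold ridgeCoord
  fun_prop

lemma measurable_stepWeight (hB : Bornology.IsBounded B) {u : E d → ℂ} (hu : Measurable u) :
    Measurable (stepWeight B u) := by
  have := measurable_supNorm hB
  unfold stepWeight ridgeSlope
  fun_prop

lemma abs_stepWeight_le {u : E d → ℂ} (hu : ∀ ω, ‖u ω‖ = 1) (p : E d × ℝ) :
    |stepWeight B u p| ≤ 1 / 2 := by
  rw [stepWeight, abs_mul, abs_of_pos one_half_pos]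
  linarith [abs_ridgeSlope_le (supNorm B p.1) (hu p.1) p.2]

lemma isFiniteMeasure_withDensity_supNorm (hB : Bornology.IsBounded B) {ν : Measure (E d)}
    (hν : ∫⁻ ω, ENNReal.ofReal ‖ω‖ ∂ν < ⊤) :
    IsFiniteMeasure (ν.withDensity fun ω => ENNReal.ofReal (supNorm B ω)) :=
  isFiniteMeasure_withDensity_ofReal (integrable_supNorm hB hν).2

lemma isFiniteMeasure_stepMeasure (hB : Bornology.IsBounded B) {ν : Measure (E d)}
    (hν : ∫⁻ ω, ENNReal.ofReal ‖ω‖ ∂ν < ⊤) : IsFiniteMeasure (stepMeasure B ν) := by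
  have := isFiniteMeasure_withDensity_supNorm hB hν
  unfold stepMeasure
  infer_instance

lemma stepMeasure_real_univ (hB : Bornology.IsBounded B) {ν : Measure (E d)}
    (hν : ∫⁻ ω, ENNReal.ofReal ‖ω‖ ∂ν < ⊤) :
    (stepMeasure B ν).real Set.univ = 2 * ∫ ω, supNorm B ω ∂ν := by
  have := isFiniteMeasure_withDensity_supNorm hB hν
  rw [stepMeasure, ← Set.univ_prod_univ, measureReal_prod_prod, measureReal_restrict_apply_univ,
    Real.volume_real_Ioc_of_le (by norm_num), Measure.real, withDensity_apply _ MeasurableSet.univ,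
    setLIntegral_univ, ← ofReal_integral_eq_lintegral_ofReal (integrable_supNorm hB hν)
      (ae_of_all _ (supNorm_nonneg B)), ENNReal.toReal_ofReal (integral_nonneg (supNorm_nonneg B))]
  ring

lemma integrable_exp_sub_one_mul (hB : Bornology.IsBounded B) {ν : Measure (E d)}
    {u : E d → ℂ} {h : E d → ℝ} (hrep : IsBarronRep B h ν u) {r : E d → ℝ} (hr : Measurable r)
    (hrB : ∀ ω, |r ω| ≤ supNorm B ω) :
    Integrable (fun ω => (Complex.exp (Complex.I * (r ω : ℂ)) - 1) * u ω) ν := by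
  have := hrep.measurable_phase
  refine (integrable_supNorm hB hrep.moment).mono' (by fun_prop) (ae_of_all _ fun ω => ?_)
  rw [norm_mul, hrep.norm_phase, mul_one]
  exact (Real.norm_exp_I_mul_ofReal_sub_one_le).trans (hrB ω)

/-- The offset in the representation of `h` by ridge steps. -/
noncomputable def stepOffset (B : Set (E d)) (h : E d → ℝ) (ν : Measure (E d)) (u : E d → ℂ) : ℝ :=
  h 0 + 1 / 2 * (∫ ω, ((Complex.exp (Complex.I * ((supNorm B ω * 1 : ℝ) : ℂ)) - 1) * u ω).re ∂ν
    + ∫ ω, ((Complex.exp (Complex.I * ((supNorm B ω * (-1) : ℝ) : ℂ)) - 1) * u ω).re ∂ν)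

/-- **Barron's representation**: on `B`, a function of Barron's class is a constant plus an integral
of the steps `±1` along the ridges `x ↦ ω ⬝ x / |ω|_B`. -/
lemma integral_stepWeight_mul_step (hB : Bornology.IsBounded B) {h : E d → ℝ} {ν : Measure (E d)}
    {u : E d → ℂ} (hrep : IsBarronRep B h ν u) {x : E d} (hx : x ∈ B) :
    ∫ p, stepWeight B u p * (if p.2 < ridgeCoord B p.1 x then 1 else -1) ∂(stepMeasure B ν) =
      h x - stepOffset B h ν u := by
  have := isFiniteMeasure_withDensity_supNorm hB hrep.moment
  have hs := measurable_supNorm hB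
  have hfin := isFiniteMeasure_stepMeasure hB hrep.moment
  have hcoord : Measurable fun ω => ridgeCoord B ω x :=
    (measurable_ridgeCoord hB).comp measurable_prodMk_right
  have hmeas : Measurable fun p : E d × ℝ =>
      stepWeight B u p * (if p.2 < ridgeCoord B p.1 x then 1 else -1) :=
    (measurable_stepWeight hB hrep.measurable_phase).mul
      (Measurable.ite (measurableSet_lt measurable_snd (hcoord.comp measurable_fst))
        measurable_const measurable_const)
  have hint : Integrable (fun p : E d × ℝ =>
      stepWeight B u p * (if p.2 < ridgeCoord B p.1 x then 1 else -1)) (stepMeasure B ν) :=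
    integrable_of_abs_le hmeas (K := 1 / 2) fun p => by
      have := abs_stepWeight_le (B := B) hrep.norm_phase p
      split_ifs <;> simpa using this
  have hix : Integrable (fun ω => ((Complex.exp (Complex.I * ((inner ℝ ω x : ℝ) : ℂ)) - 1)
      * u ω)) ν :=
    integrable_exp_sub_one_mul hB hrep (by fun_prop) fun ω => abs_inner_le_supNorm hB ω hx
  have hi1 := (integrable_exp_sub_one_mul hB hrep (r := fun ω => supNorm B ω * 1) (by fun_prop)
    fun ω => by rw [mul_one, abs_of_nonneg (supNorm_nonneg B ω)]).re
  have hi2 := (integrable_exp_sub_one_mul hB hrep (r := fun ω => supNorm B ω * (-1)) (by fun_prop)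
    fun ω => by rw [mul_neg_one, abs_neg, abs_of_nonneg (supNorm_nonneg B ω)]).re
  have hre : h x = h 0 + ∫ ω, ((Complex.exp (Complex.I * ((inner ℝ ω x : ℝ) : ℂ)) - 1)
      * u ω).re ∂ν := by
    have h1 := congrArg Complex.re (hrep.repr x hx)
    have h2 := integral_re hix
    simp only [RCLike.re_eq_complex_re] at h2
    rw [h2]
    simpa using h1
  have hslice (ω : E d) :
      (supNorm B ω) * ∫ t in Set.Ioc (-1 : ℝ) 1,
        stepWeight B u (ω, t) * (if t < ridgeCoord B ω x then 1 else -1) =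
      ((Complex.exp (Complex.I * ((inner ℝ ω x : ℝ) : ℂ)) - 1) * u ω).re
        - 1 / 2 * (((Complex.exp (Complex.I * ((supNorm B ω * 1 : ℝ) : ℂ)) - 1) * u ω).re
        + ((Complex.exp (Complex.I * ((supNorm B ω * (-1) : ℝ) : ℂ)) - 1) * u ω).re) := by
    have := integral_ridgeSlope_mul_step (supNorm B ω) (u ω) (abs_ridgeCoord_le hB ω hx)
    rw [supNorm_mul_ridgeCoord hB ω hx] at this
    simp only [stepWeight, mul_assoc (1 / 2 : ℝ)]
    rw [integral_const_mul]
    linarith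
  rw [stepMeasure, integral_prod _ hint, integral_withDensity_eq_integral_toReal_smul
    (by fun_prop) (ae_of_all _ fun _ => ENNReal.ofReal_lt_top)]
  simp only [smul_eq_mul, ENNReal.toReal_ofReal (supNorm_nonneg B _), hslice]
  have hix' := hix.re
  simp only [RCLike.re_eq_complex_re] at hix' hi1 hi2
  have hi12 : Integrable (fun ω =>
      ((Complex.exp (Complex.I * ((supNorm B ω * 1 : ℝ) : ℂ)) - 1) * u ω).re
        + ((Complex.exp (Complex.I * ((supNorm B ω * (-1) : ℝ) : ℂ)) - 1) * u ω).re) ν :=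
    hi1.add hi2
  rw [integral_sub hix' (hi12.const_mul _), integral_const_mul, integral_add hi1 hi2,
    stepOffset, hre]
  ring

/-- A sigmoidal ridge unit with steepness `N`, replacing the step with parameters `p = (ω, t)`. -/
noncomputable def sigmoidUnit (B : Set (E d)) (u : E d → ℂ) (φ : ℝ → ℝ) (N : ℕ) (p : E d × ℝ)
    (x : E d) : ℝ :=
  stepWeight B u p * φ (N * (ridgeCoord B p.1 x - p.2))

lemma measurable_sigmoidUnit (hB : Bornology.IsBounded B) {u : E d → ℂ} (hu : Measurable u)
    {φ : ℝ → ℝ} (hφ : Measurable φ) (N : ℕ) {α : Type*} [MeasurableSpace α] {f : α → E d × ℝ}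
    {g : α → E d} (hf : Measurable f) (hg : Measurable g) :
    Measurable fun a => sigmoidUnit B u φ N (f a) (g a) := by
  have h1 : Measurable fun a => ridgeCoord B (f a).1 (g a) :=
    (measurable_ridgeCoord hB).comp (hf.fst.prodMk hg)
  exact ((measurable_stepWeight hB hu).comp hf).mul (hφ.comp ((h1.sub hf.snd).const_mul _))

lemma measurable_integral_sigmoidUnit (hB : Bornology.IsBounded B) {u : E d → ℂ}
    (hu : Measurable u) {φ : ℝ → ℝ} (hφ : Measurable φ) (N : ℕ) (M : Measure (E d × ℝ))
    [IsFiniteMeasure M] {Ω : Type*} [MeasurableSpace Ω] {X : Ω → E d} (hX : Measurable X) :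
    Measurable fun w => ∫ p, sigmoidUnit B u φ N p (X w) ∂M := by
  have h1 : Measurable fun q : (E d × ℝ) × Ω => sigmoidUnit B u φ N q.1 (X q.2) :=
    measurable_sigmoidUnit hB hu hφ N measurable_fst (hX.comp measurable_snd)
  exact (StronglyMeasurable.integral_prod_left' h1.stronglyMeasurable).measurable

lemma abs_sigmoidUnit_le {u : E d → ℂ} (hu : ∀ ω, ‖u ω‖ = 1) {φ : ℝ → ℝ} (hφ : IsSigmoidal φ)
    (N : ℕ) (p : E d × ℝ) (x : E d) : |sigmoidUnit B u φ N p x| ≤ 1 / 2 := by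
  rw [sigmoidUnit, abs_mul]
  calc _ ≤ 1 / 2 * 1 := mul_le_mul (abs_stepWeight_le hu p) (abs_le.2 (hφ.mem_Icc _))
        (abs_nonneg _) (by norm_num)
    _ = 1 / 2 := mul_one _

lemma abs_integral_sigmoidUnit_le (hB : Bornology.IsBounded B) {h : E d → ℝ} {ν : Measure (E d)}
    {u : E d → ℂ} (hrep : IsBarronRep B h ν u) {φ : ℝ → ℝ} (hφ : IsSigmoidal φ) (N : ℕ) (x : E d) :
    |∫ p, sigmoidUnit B u φ N p x ∂(stepMeasure B ν)| ≤ ∫ ω, supNorm B ω ∂ν := by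
  have := isFiniteMeasure_stepMeasure hB hrep.moment
  have h1 := norm_integral_le_of_norm_le_const (μ := stepMeasure B ν)
    (f := fun p => sigmoidUnit B u φ N p x)
    (C := 1 / 2) (ae_of_all _ fun p => abs_sigmoidUnit_le (B := B) hrep.norm_phase hφ N p x)
  rw [stepMeasure_real_univ hB hrep.moment, Real.norm_eq_abs] at h1
  linarith

/-- As the steepness grows, the units converge to steps off the jump `t = ω ⬝ x / |ω|_B`, which is
a null set of parameters whatever the value of `φ 0`. -/
lemma tendsto_integral_sigmoidUnit (hB : Bornology.IsBounded B) {h : E d → ℝ} {ν : Measure (E d)}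
    {u : E d → ℂ} (hrep : IsBarronRep B h ν u) {φ : ℝ → ℝ} (hφ : IsSigmoidal φ) {x : E d}
    (hx : x ∈ B) :
    Tendsto (fun N : ℕ => ∫ p, sigmoidUnit B u φ N p x ∂(stepMeasure B ν)) atTop
      (𝓝 (h x - stepOffset B h ν u)) := by
  have := isFiniteMeasure_withDensity_supNorm hB hrep.moment
  have hfin := isFiniteMeasure_stepMeasure hB hrep.moment
  rw [← integral_stepWeight_mul_step hB hrep hx]
  have hcoord : Measurable fun ω => ridgeCoord B ω x :=
    (measurable_ridgeCoord hB).comp measurable_prodMk_right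
  have hne : ∀ᵐ p ∂(stepMeasure B ν), p.2 ≠ ridgeCoord B p.1 x := by
    have hset : MeasurableSet {p : E d × ℝ | p.2 ≠ ridgeCoord B p.1 x} :=
      (measurableSet_eq_fun measurable_snd (hcoord.comp measurable_fst)).compl
    rw [stepMeasure, Measure.ae_prod_iff_ae_ae hset]
    exact ae_of_all _ fun ω => ae_restrict_of_ae (Measure.ae_ne volume (ridgeCoord B ω x))
  have hbound (N : ℕ) (p : E d × ℝ) : ‖sigmoidUnit B u φ N p x‖ ≤ 1 / 2 :=
    abs_sigmoidUnit_le hrep.norm_phase hφ N p x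
  refine tendsto_integral_of_dominated_convergence (fun _ => 1 / 2)
    (fun N => (measurable_sigmoidUnit hB hrep.measurable_phase hφ.measurable N
      measurable_id measurable_const).aestronglyMeasurable) (integrable_const _)
    (fun N => ae_of_all _ (hbound N)) ?_
  filter_upwards [hne] with p hp
  refine Tendsto.const_mul _ ?_
  split_ifs with hlt
  · exact hφ.tendsto_atTop.comp
      (tendsto_natCast_atTop_atTop.atTop_mul_const (sub_pos.2 hlt))
  · exact hφ.tendsto_atBot.comp (tendsto_natCast_atTop_atTop.atTop_mul_const_of_neg
      (sub_neg.2 (lt_of_le_of_ne (not_lt.1 hlt) hp.symm)))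

lemma sum_sigmoidUnit_mem_twoLayer (u : E d → ℂ) (φ : ℝ → ℝ) (N : ℕ) {k : ℕ} (c₀ c : ℝ)
    (θ : Fin k → E d × ℝ) :
    (fun x => c₀ + ∑ i, c * sigmoidUnit B u φ N (θ i) x) ∈ twoLayer d φ k := by
  refine ⟨c₀, fun i => c * stepWeight B u (θ i), fun i => -(N * (θ i).2),
    fun i => (N / supNorm B (θ i).1) • (θ i).1, fun x => ?_⟩
  change c₀ + ∑ i, c * sigmoidUnit B u φ N (θ i) x = _
  refine congrArg (c₀ + ·) (Finset.sum_congr rfl fun i _ => ?_)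
  rw [sigmoidUnit, ridgeCoord, real_inner_smul_left, mul_assoc]
  congr 3
  ring

/-- The networks with infinitely many sigmoidal units converge in mean square to a function of
Barron's class. -/
lemma tendsto_integral_sq_sub_integral_sigmoidUnit {Ω : Type*} [MeasurableSpace Ω]
    {P : Measure Ω} [IsProbabilityMeasure P] {X : Ω → E d} (hX : Measurable X)
    (hXB : ∀ᵐ w ∂P, X w ∈ B) (hB : Bornology.IsBounded B) {h : E d → ℝ} {ν : Measure (E d)}
    {u : E d → ℂ} (hrep : IsBarronRep B h ν u) {φ : ℝ → ℝ} (hφ : IsSigmoidal φ) :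
    (∀ N, Integrable (fun w => (h (X w) - stepOffset B h ν u
      - ∫ p, sigmoidUnit B u φ N p (X w) ∂(stepMeasure B ν)) ^ 2) P) ∧
    Tendsto (fun N => ∫ w, (h (X w) - stepOffset B h ν u
      - ∫ p, sigmoidUnit B u φ N p (X w) ∂(stepMeasure B ν)) ^ 2 ∂P) atTop (𝓝 0) := by
  have hfin := isFiniteMeasure_stepMeasure hB hrep.moment
  set m := ∫ ω, supNorm B ω ∂ν with hm
  set c₀ := stepOffset B h ν u with hc₀
  set f : ℕ → Ω → ℝ := fun N w => ∫ p, sigmoidUnit B u φ N p (X w) ∂(stepMeasure B ν) with hf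
  have hfm (N : ℕ) : Measurable (f N) :=
    measurable_integral_sigmoidUnit hB hrep.measurable_phase hφ.measurable N _ hX
  have hfb (N : ℕ) (w : Ω) : |f N w| ≤ m := abs_integral_sigmoidUnit_le hB hrep hφ N (X w)
  have hlim : ∀ᵐ w ∂P, Tendsto (fun N => f N w) atTop (𝓝 (h (X w) - c₀)) :=
    hXB.mono fun w hw => tendsto_integral_sigmoidUnit hB hrep hφ hw
  have hmeas : AEStronglyMeasurable (fun w => h (X w) - c₀) P :=
    aestronglyMeasurable_of_tendsto_ae atTop (fun N => (hfm N).aestronglyMeasurable) hlim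
  have herr_m (N : ℕ) : AEStronglyMeasurable (fun w => (h (X w) - c₀ - f N w) ^ 2) P :=
    (hmeas.sub (hfm N).aestronglyMeasurable).pow 2
  have herr_b (N : ℕ) : ∀ᵐ w ∂P, ‖(h (X w) - c₀ - f N w) ^ 2‖ ≤ (m + m) ^ 2 := by
    filter_upwards [hlim] with w hw
    rw [norm_pow, Real.norm_eq_abs]
    gcongr
    exact (abs_sub _ _).trans
      (add_le_add (le_of_tendsto' hw.abs fun N => hfb N w) (hfb N w))
  refine ⟨fun N => Integrable.of_bound (herr_m N) _ (herr_b N), ?_⟩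
  have := tendsto_integral_of_dominated_convergence (fun _ => (m + m) ^ 2) herr_m
    (integrable_const _) herr_b (f := fun _ => 0) (by
      filter_upwards [hlim] with w hw
      simpa using (hw.const_sub (h (X w) - c₀)).pow 2)
  simpa using this

/-- Sampling `k` units of a network with infinitely many sigmoidal units. -/
lemma exists_twoLayer_sub_integral_sigmoidUnit_sq_le {Ω : Type*} [MeasurableSpace Ω]
    {P : Measure Ω} [IsProbabilityMeasure P] {X : Ω → E d} (hX : Measurable X)
    (hB : Bornology.IsBounded B) {h : E d → ℝ} {ν : Measure (E d)}
    {u : E d → ℂ} (hrep : IsBarronRep B h ν u) {φ : ℝ → ℝ} (hφ : IsSigmoidal φ) (N : ℕ)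
    {k : ℕ} (hk : 0 < k) :
    ∃ S : E d → ℝ, (∀ c₀, (fun x => c₀ + S x) ∈ twoLayer d φ k) ∧ Measurable S ∧
      (∀ x, |S x| ≤ ∫ ω, supNorm B ω ∂ν) ∧
      Integrable (fun w => (S (X w) - ∫ p, sigmoidUnit B u φ N p (X w) ∂(stepMeasure B ν)) ^ 2) P ∧
      ∫ w, (S (X w) - ∫ p, sigmoidUnit B u φ N p (X w) ∂(stepMeasure B ν)) ^ 2 ∂P ≤
        (∫ ω, supNorm B ω ∂ν) ^ 2 / k := by
  have hfin := isFiniteMeasure_stepMeasure hB hrep.moment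
  have hm0 : 0 ≤ ∫ ω, supNorm B ω ∂ν := integral_nonneg (supNorm_nonneg B)
  have hGX : Measurable fun q : (E d × ℝ) × Ω => sigmoidUnit B u φ N q.1 (X q.2) :=
    measurable_sigmoidUnit hB hrep.measurable_phase hφ.measurable N measurable_fst
      (hX.comp measurable_snd)
  obtain ⟨θ, hθ⟩ := exists_sum_sub_integral_sq_le P (stepMeasure B ν) hGX (K := 1 / 2)
    (fun p w => abs_sigmoidUnit_le hrep.norm_phase hφ N p (X w)) hk
  rw [stepMeasure_real_univ hB hrep.moment] at hθ
  have hfb (w : Ω) : |∫ p, sigmoidUnit B u φ N p (X w) ∂(stepMeasure B ν)| ≤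
    ∫ ω, supNorm B ω ∂ν := abs_integral_sigmoidUnit_le hB hrep hφ N (X w)
  have hfm : Measurable fun w => ∫ p, sigmoidUnit B u φ N p (X w) ∂(stepMeasure B ν) :=
    measurable_integral_sigmoidUnit hB hrep.measurable_phase hφ.measurable N _ hX
  obtain ⟨m, hm⟩ : ∃ m, ∫ ω, supNorm B ω ∂ν = m := ⟨_, rfl⟩
  rw [hm] at hm0 hθ ⊢
  simp only [hm] at hfb
  have hSm : Measurable fun x => ∑ i, 2 * m / k * sigmoidUnit B u φ N (θ i) x :=
    Finset.measurable_fun_sum _ fun i _ => (measurable_sigmoidUnit hB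
      hrep.measurable_phase hφ.measurable N measurable_const measurable_id).const_mul _
  have hSb (x : E d) : |∑ i, 2 * m / k * sigmoidUnit B u φ N (θ i) x| ≤ m := by
    refine (Finset.abs_sum_le_sum_abs _ _).trans ?_
    calc ∑ i, |2 * m / k * sigmoidUnit B u φ N (θ i) x|
        ≤ ∑ _i : Fin k, 2 * m / k * (1 / 2) := by
          refine Finset.sum_le_sum fun i _ => ?_
          rw [abs_mul, abs_of_nonneg (by positivity)]
          exact mul_le_mul_of_nonneg_left
            (abs_sigmoidUnit_le hrep.norm_phase hφ N (θ i) x) (by positivity)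
      _ = m := by
          simp only [Finset.sum_const, Finset.card_univ, Fintype.card_fin, nsmul_eq_mul]
          have hk' : (k : ℝ) ≠ 0 := Nat.cast_ne_zero.2 hk.ne'
          field_simp
  refine ⟨fun x => ∑ i, 2 * m / k * sigmoidUnit B u φ N (θ i) x,
    fun c₀ => sum_sigmoidUnit_mem_twoLayer u φ N c₀ _ θ, hSm, hSb, ?_, ?_⟩
  · refine integrable_of_abs_le (((hSm.comp hX).sub hfm).pow_const 2) (K := (m + m) ^ 2) fun w => ?_
    rw [abs_pow]
    exact pow_le_pow_left₀ (abs_nonneg _)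
      ((abs_sub _ _).trans (add_le_add (hSb (X w)) (hfb w))) 2
  · calc _ ≤ (2 * m * (1 / 2)) ^ 2 / k := hθ
      _ = m ^ 2 / k := by ring

/-- **Barron's approximation theorem**. Besides the mean square error, the network and its target
are confined to a common interval of half-width `D`. -/
theorem exists_twoLayer_integral_sq_le {Ω : Type*} [MeasurableSpace Ω] {P : Measure Ω}
    [IsProbabilityMeasure P] {X : Ω → E d} (hX : Measurable X) (hXB : ∀ᵐ w ∂P, X w ∈ B)
    (hB : Bornology.IsBounded B) {η : E d → ℝ} (hη : η ∈ barronClass B) {D : ℝ}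
    (hD : barronConst B η < D) {φ : ℝ → ℝ} (hφ : IsSigmoidal φ) {k : ℕ} (hk : 0 < k) :
    ∃ c₀ : ℝ, (∀ x ∈ B, |η x - c₀| ≤ D) ∧ ∃ h ∈ twoLayer d φ k, Measurable h ∧
      (∀ x, |h x - c₀| ≤ D) ∧ ∫ w, (η (X w) - h (X w)) ^ 2 ∂P ≤ 4 * D ^ 2 / k := by
  have hk' : (0 : ℝ) < k := Nat.cast_pos.2 hk
  have hD0 : 0 < D := (barronConst_nonneg B η).trans_lt hD
  obtain ⟨ν, u, hrep, hlt⟩ := exists_isBarronRep_lt hη hD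
  have hm0 : 0 ≤ ∫ ω, supNorm B ω ∂ν := integral_nonneg (supNorm_nonneg B)
  obtain ⟨hi2, herr⟩ := tendsto_integral_sq_sub_integral_sigmoidUnit hX hXB hB hrep hφ
  -- the error of the passage from steps to sigmoids is kept below that of the sampling
  obtain ⟨N, hN⟩ := (herr.eventually_lt_const (show (0 : ℝ) < D ^ 2 / k by positivity)).exists
  obtain ⟨S, hmem, hSm, hSb, hi1, hS⟩ :=
    exists_twoLayer_sub_integral_sigmoidUnit_sq_le (P := P) hX hB hrep hφ N hk
  have hηc (x : E d) (hx : x ∈ B) : |η x - stepOffset B η ν u| ≤ ∫ ω, supNorm B ω ∂ν :=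
    le_of_tendsto' (tendsto_integral_sigmoidUnit hB hrep hφ hx).abs
      fun N => abs_integral_sigmoidUnit_le hB hrep hφ N x
  refine ⟨stepOffset B η ν u, fun x hx => (hηc x hx).trans hlt.le, _, hmem _, hSm.const_add _,
    fun x => by rw [add_sub_cancel_left]; exact (hSb x).trans hlt.le, ?_⟩
  have hle := integral_mono_of_nonneg (f := fun w => (η (X w) - (stepOffset B η ν u + S (X w))) ^ 2)
    (ae_of_all _ fun _ => sq_nonneg _) ((hi1.const_mul 2).add ((hi2 N).const_mul 2))
    (ae_of_all _ fun w => by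
      simp only [Pi.add_apply]
      generalize ∫ p, sigmoidUnit B u φ N p (X w) ∂(stepMeasure B ν) = y
      linarith [sq_nonneg ((S (X w) - y) + (η (X w) - stepOffset B η ν u - y))])
  rw [integral_add' (hi1.const_mul 2) ((hi2 N).const_mul 2), integral_const_mul,
    integral_const_mul] at hle
  have hmD : (∫ ω, supNorm B ω ∂ν) ^ 2 / k ≤ D ^ 2 / k := by gcongr
  calc _ ≤ _ := hle
    _ ≤ 2 * (D ^ 2 / k) + 2 * (D ^ 2 / k) := by linarith
    _ = 4 * D ^ 2 / k := by ring

/-! ### Concentration -/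

variable {Ω : Type*} [MeasurableSpace Ω]

/-- Hoeffding's inequality in terms of the confidence level. -/
lemma ofReal_one_sub_le_measure_mean_le {P : Measure Ω} [IsProbabilityMeasure P] {n : ℕ}
    (hn : 0 < n) {δ : ℝ} (hδ0 : 0 < δ) (hδ1 : δ ≤ 1) {L : Fin n → Ω → ℝ}
    (hL : ∀ i, Measurable (L i)) (hind : iIndepFun L P) {b e : ℝ} (hb : 0 < b)
    (hLb : ∀ i, ∀ᵐ w ∂P, L i w ∈ Set.Icc 0 b) (he : ∀ i, ∫ w, L i w ∂P = e) :
    ENNReal.ofReal (1 - δ) ≤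
      P {w | (1 / (n : ℝ)) * ∑ i, L i w ≤ e + b / 2 * √(2 * Real.log (1 / δ) / n)} := by
  have hn' : (0 : ℝ) < n := Nat.cast_pos.2 hn
  have hlog : 0 ≤ Real.log (1 / δ) := Real.log_nonneg (one_le_one_div hδ0 hδ1)
  set t := b / 2 * √(2 * Real.log (1 / δ) / n) with ht
  have ht2 : t ^ 2 = b ^ 2 * Real.log (1 / δ) / (2 * n) := by
    rw [ht, mul_pow, Real.sq_sqrt (by positivity)]
    field_simp
  have hsub (i : Fin n) : HasSubgaussianMGF (fun w => L i w - e) ((‖b - 0‖₊ / 2) ^ 2) P := by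
    simpa only [he i] using hasSubgaussianMGF_of_mem_Icc (hL i).aemeasurable (hLb i)
  have htail : P.real {w | n * t ≤ ∑ i, (L i w - e)} ≤ δ := by
    have h := HasSubgaussianMGF.measure_sum_ge_le_of_iIndepFun (s := Finset.univ) (ε := n * t)
      (hind.comp (fun _ x => x - e) fun _ => by fun_prop) (fun i _ => hsub i) (by positivity)
    refine h.trans (le_of_eq ?_)
    have hexp : -(n * t) ^ 2 / (2 * ((∑ _i : Fin n, (‖b - 0‖₊ / 2) ^ 2 : NNReal) : ℝ)) =
        Real.log δ := by
      simp only [sub_zero, Finset.sum_const, Finset.card_univ, Fintype.card_fin, nsmul_eq_mul]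
      push_cast
      rw [Real.norm_of_nonneg hb.le]
      rw [mul_pow, ht2, one_div, Real.log_inv]
      field_simp
    rw [hexp, Real.exp_log hδ0]
  have hmeas : MeasurableSet {w | n * t ≤ ∑ i, (L i w - e)} :=
    measurableSet_le measurable_const
      (Finset.measurable_fun_sum _ fun i _ => (hL i).sub_const e)
  have hcompl : ENNReal.ofReal (1 - δ) ≤ P {w | n * t ≤ ∑ i, (L i w - e)}ᶜ := by
    rw [← ofReal_measureReal, probReal_compl_eq_one_sub hmeas]
    exact ENNReal.ofReal_le_ofReal (by linarith)
  refine hcompl.trans (measure_mono fun w hw => ?_)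
  have hw' : ∑ i, (L i w - e) < n * t := not_le.1 hw
  rw [Finset.sum_sub_distrib, Finset.sum_const, Finset.card_univ, Fintype.card_fin,
    nsmul_eq_mul] at hw'
  change (1 / (n : ℝ)) * ∑ i, L i w ≤ e + t
  rw [one_div_mul_eq_div, div_le_iff₀ hn']
  linarith

/-- A limsup of events of probability at least `p` has probability at least `p`. -/
lemma le_measure_limsup_of_le {P : Measure Ω} [IsFiniteMeasure P] {A : ℕ → Set Ω}
    (hA : ∀ j, MeasurableSet (A j)) {p : ENNReal} (hp : ∀ j, p ≤ P (A j)) :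
    p ≤ P (limsup A atTop) := by
  rw [limsup_eq_iInf_iSup_of_nat]
  simp only [Set.iInf_eq_iInter, Set.iSup_eq_iUnion]
  have hanti : Antitone fun j => ⋃ i ≥ j, A i := fun a b hab =>
    Set.biUnion_subset_biUnion_left fun i hi => le_trans hab hi
  refine ge_of_tendsto' (tendsto_measure_iInter_atTop (fun j => (MeasurableSet.biUnion
    (Set.to_countable _) fun i _ => hA i).nullMeasurableSet) hanti ⟨0, measure_ne_top _ _⟩)
    fun j => (hp j).trans (measure_mono (Set.subset_biUnion_of_mem (u := A) (le_refl j)))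

/-! ### The minimum mean square error -/

lemma ae_condExp_mem_Icc {P : Measure Ω} {Y : Ω → ℝ} (m : MeasurableSpace Ω)
    (hY1 : ∀ᵐ w ∂P, Y w ∈ Set.Icc (-1 : ℝ) 1) :
    ∀ᵐ w ∂P, (P[Y | m]) w ∈ Set.Icc (-1 : ℝ) 1 :=
  (ae_bdd_abs_condExp_of_ae_bdd_abs (R := 1) (m := m) (hY1.mono fun _ h => abs_le.2 h)).mono
    fun _ h => abs_le.1 h

section CondExp

variable {P : Measure Ω} [IsProbabilityMeasure P] {X : Ω → E d} {Y : Ω → ℝ}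

lemma memLp_two_of_ae_mem_Icc {f : Ω → ℝ} (hf : AEStronglyMeasurable f P)
    (h1 : ∀ᵐ w ∂P, f w ∈ Set.Icc (-1 : ℝ) 1) : MemLp f 2 P :=
  MemLp.of_bound hf 1 (h1.mono fun _ h => abs_le.2 h)

/-- Pythagoras for the conditional expectation as an orthogonal projection. -/
lemma integral_sq_sub_eq_add (hX : Measurable X) (hY : Measurable Y)
    (hY1 : ∀ᵐ w ∂P, Y w ∈ Set.Icc (-1 : ℝ) 1) {h : E d → ℝ} (hh : Measurable h)
    (hL2 : MemLp (fun w => h (X w)) 2 P) :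
    ∫ w, (Y w - h (X w)) ^ 2 ∂P =
      ∫ w, (Y w - (P[Y | MeasurableSpace.comap X inferInstance]) w) ^ 2 ∂P +
      ∫ w, ((P[Y | MeasurableSpace.comap X inferInstance]) w - h (X w)) ^ 2 ∂P := by
  set Z := P[Y | MeasurableSpace.comap X inferInstance] with hZ
  have hm : MeasurableSpace.comap X inferInstance ≤ ‹MeasurableSpace Ω› := hX.comap_le
  have hY2 : MemLp Y 2 P := memLp_two_of_ae_mem_Icc hY.aestronglyMeasurable hY1
  have hZm : StronglyMeasurable[MeasurableSpace.comap X inferInstance] Z :=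
    stronglyMeasurable_condExp
  have hZ2 : MemLp Z 2 P := memLp_two_of_ae_mem_Icc (hZm.mono hm).aestronglyMeasurable
    (ae_condExp_mem_Icc _ hY1)
  set V : Ω → ℝ := fun w => Z w - h (X w) with hV
  have hV2 : MemLp V 2 P := hZ2.sub hL2
  have hVm : StronglyMeasurable[MeasurableSpace.comap X inferInstance] V :=
    hZm.sub (hh.comp (comap_measurable X)).stronglyMeasurable
  have hVY : Integrable (V * Y) P := hV2.integrable_mul hY2
  have hVZ : Integrable (V * Z) P := hV2.integrable_mul hZ2
  have horth : ∫ w, (V * Y) w ∂P = ∫ w, (V * Z) w ∂P := by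
    rw [← integral_condExp hm]
    exact integral_congr_ae
      (condExp_mul_of_stronglyMeasurable_left hVm hVY (hY2.integrable one_le_two))
  have hYZ : Integrable (fun w => (Y w - Z w) ^ 2) P := (hY2.sub hZ2).integrable_sq
  have hVV : Integrable (fun w => V w ^ 2) P := hV2.integrable_sq
  have heq (w : Ω) : (Y w - h (X w)) ^ 2 =
      ((Y w - Z w) ^ 2 + V w ^ 2) + 2 * ((V * Y) w - (V * Z) w) := by
    simp only [hV, Pi.mul_apply]; ring
  simp_rw [heq]
  have hsum : Integrable (fun w => (Y w - Z w) ^ 2 + V w ^ 2) P := hYZ.add hVV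
  have hcross : Integrable (fun w => (V * Y) w - (V * Z) w) P := hVY.sub hVZ
  rw [integral_add hsum (hcross.const_mul 2), integral_add hYZ hVV,
    integral_const_mul, integral_sub hVY hVZ, horth, sub_self, mul_zero, add_zero]

lemma integral_sq_sub_condExp_le_mmse (hX : Measurable X) (hY : Measurable Y)
    (hY1 : ∀ᵐ w ∂P, Y w ∈ Set.Icc (-1 : ℝ) 1) :
    ∫ w, (Y w - (P[Y | MeasurableSpace.comap X inferInstance]) w) ^ 2 ∂P ≤ mmse P X Y := by
  have hY2 : MemLp Y 2 P := memLp_two_of_ae_mem_Icc hY.aestronglyMeasurable hY1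
  rw [mmse, ← ENNReal.ofReal_le_iff_le_toReal]
  · refine le_iInf fun h => ?_
    have hhX : Measurable fun w => h.1 (X w) := h.2.comp hX
    by_cases hfin : ∫⁻ w, ENNReal.ofReal ((Y w - h.1 (X w)) ^ 2) ∂P = ⊤
    · rw [hfin]; exact le_top
    have hsq : Integrable (fun w => (Y w - h.1 (X w)) ^ 2) P :=
      (lintegral_ofReal_ne_top_iff_integrable
        ((hY.sub hhX).pow_const 2).aestronglyMeasurable (ae_of_all _ fun _ => sq_nonneg _)).1 hfin
    have hdiff : MemLp (fun w => Y w - h.1 (X w)) 2 P :=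
      (memLp_two_iff_integrable_sq (hY.sub hhX).aestronglyMeasurable).2 hsq
    have hL2 : MemLp (fun w => h.1 (X w)) 2 P := by
      simpa [Pi.sub_def] using hY2.sub hdiff
    rw [← ofReal_integral_eq_lintegral_ofReal hsq (ae_of_all _ fun _ => sq_nonneg _),
      integral_sq_sub_eq_add hX hY hY1 h.2 hL2]
    exact ENNReal.ofReal_le_ofReal
      (le_add_of_nonneg_right (integral_nonneg fun _ => sq_nonneg _))
  · refine ne_top_of_le_ne_top ?_ (iInf_le _ ⟨fun _ => 0, measurable_const⟩)
    simpa using (lintegral_ofReal_ne_top_iff_integrable (hY.pow_const 2).aestronglyMeasurable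
      (ae_of_all _ fun _ => sq_nonneg _)).2 hY2.integrable_sq

end CondExp

lemma mmseEmp_le_empLoss {n k : ℕ} {φ : ℝ → ℝ} {h : E d → ℝ} (hh : h ∈ twoLayer d φ k)
    (x : Fin n → E d) (y : Fin n → ℝ) : mmseEmp φ k x y ≤ empLoss x y h := by
  refine ciInf_le ⟨0, ?_⟩ (⟨h, hh⟩ : twoLayer d φ k)
  rintro _ ⟨g, rfl⟩
  exact mul_nonneg (by positivity) (Finset.sum_nonneg fun _ _ => sq_nonneg _)

lemma continuous_epsErr (k n : ℕ) (δ : ℝ) : Continuous fun C => epsErr C k n δ := by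
  unfold epsErr
  fun_prop

end NNMMSE

theorem theorem1
    {Ω : Type*} [MeasurableSpace Ω] (P : Measure Ω) [IsProbabilityMeasure P]
    (d k n : ℕ) (hk : 0 < k) (hn : 0 < n)
    (δ : ℝ) (hδ0 : 0 < δ) (hδ1 : δ ≤ 1)
    (φ : ℝ → ℝ) (hφ : NNMMSE.IsSigmoidal φ)
    (B : Set (NNMMSE.E d)) (hB : Bornology.IsBounded B) (h0 : (0 : NNMMSE.E d) ∈ B)
    -- the pair `(X, Y)`
    (X : Ω → NNMMSE.E d) (Y : Ω → ℝ) (hX : Measurable X) (hY : Measurable Y)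
    (hXB : ∀ᵐ w ∂P, X w ∈ B) (hY1 : ∀ᵐ w ∂P, Y w ∈ Set.Icc (-1 : ℝ) 1)
    -- the conditional expectation `η(x) = 𝔼[Y | X = x]`, which belongs to `Γ_B`
    (η : NNMMSE.E d → ℝ)
    (hη : (fun w => η (X w)) =ᵐ[P] P[Y | MeasurableSpace.comap X inferInstance])
    (hηB : η ∈ NNMMSE.barronClass B)
    -- the random sample `(X₁, Y₁), …, (Xₙ, Yₙ)`: independent copies of `(X, Y)`
    (Xs : Fin n → Ω → NNMMSE.E d) (Ys : Fin n → Ω → ℝ)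
    (hXs : ∀ i, Measurable (Xs i)) (hYs : ∀ i, Measurable (Ys i))
    (hindep : iIndepFun (fun i w => (Xs i w, Ys i w)) P)
    (hident : ∀ i, IdentDistrib (fun w => (Xs i w, Ys i w)) (fun w => (X w, Y w)) P P) :
    ∃ A : Set Ω, MeasurableSet A ∧ ENNReal.ofReal (1 - δ) ≤ P A ∧
      ∀ w ∈ A,
        NNMMSE.mmseEmp φ k (fun i => Xs i w) (fun i => Ys i w)
            - NNMMSE.epsErr (NNMMSE.barronConst B η) k n δ
          ≤ NNMMSE.mmse P X Y := by
  open NNMMSE in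
  -- the bound for every `D` above the Barron constant, which need not be attained
  have key : ∀ D, barronConst B η < D → ∃ A : Set Ω, MeasurableSet A ∧
      ENNReal.ofReal (1 - δ) ≤ P A ∧ ∀ w ∈ A,
        mmseEmp φ k (fun i => Xs i w) (fun i => Ys i w) ≤ mmse P X Y + epsErr D k n δ := by
    intro D hD
    have hD0 : 0 < D := (barronConst_nonneg B η).trans_lt hD
    obtain ⟨c₀, hηc, h, hh, hhm, hhc, herr⟩ :=
      exists_twoLayer_integral_sq_le hX hXB hB hηB hD hφ hk
    have hη1 : ∀ᵐ w ∂P, η (X w) ∈ Set.Icc (-1 : ℝ) 1 := by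
      filter_upwards [hη, ae_condExp_mem_Icc _ hY1] with w h1 h2
      rw [h1]; exact h2
    -- `η 0` need not lie in `[-1, 1]`; the offset `c₀` is controlled at a typical value of `X` instead
    obtain ⟨w₀, hw₀B, hw₀⟩ := (hXB.and hη1).exists
    have hhb (x : E d) : |h x| ≤ 1 + 2 * D := by
      have h1 := abs_le.1 (hηc _ hw₀B)
      have h2 := abs_le.1 (hhc x)
      exact abs_le.2 ⟨by linarith [h1.2, h2.1, hw₀.1], by linarith [h1.1, h2.2, hw₀.2]⟩
    set ℓ : E d × ℝ → ℝ := fun q => (q.2 - h q.1) ^ 2 with hℓ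
    have hℓm : Measurable ℓ := (measurable_snd.sub (hhm.comp measurable_fst)).pow_const 2
    have hℓb : ∀ᵐ w ∂P, ℓ (X w, Y w) ∈ Set.Icc 0 (4 * (1 + D) ^ 2) := by
      filter_upwards [hY1] with w hw
      have h1 := abs_le.1 (hhb (X w))
      refine ⟨sq_nonneg _, ?_⟩
      have : (Y w - h (X w)) ^ 2 ≤ (2 * (1 + D)) ^ 2 :=
        sq_le_sq' (by linarith [hw.1, h1.2]) (by linarith [hw.2, h1.1])
      calc _ ≤ _ := this
        _ = 4 * (1 + D) ^ 2 := by ring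
    have hrisk : ∫ w, ℓ (X w, Y w) ∂P ≤ mmse P X Y + 4 * D ^ 2 / k := by
      have hL2 : MemLp (fun w => h (X w)) 2 P :=
        MemLp.of_bound (hhm.comp hX).aestronglyMeasurable (1 + 2 * D) (ae_of_all _ fun w => hhb _)
      change ∫ w, (Y w - h (X w)) ^ 2 ∂P ≤ _
      rw [integral_sq_sub_eq_add hX hY hY1 hhm hL2]
      refine add_le_add (integral_sq_sub_condExp_le_mmse hX hY hY1) (le_trans (le_of_eq ?_) herr)
      exact integral_congr_ae (hη.mono fun w hw => by simp only [← hw])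
    have hid (i : Fin n) : IdentDistrib (fun w => ℓ (Xs i w, Ys i w)) (fun w => ℓ (X w, Y w)) P P :=
      (hident i).comp hℓm
    have hLm (i : Fin n) : Measurable fun w => ℓ (Xs i w, Ys i w) :=
      hℓm.comp ((hXs i).prodMk (hYs i))
    have hprob := ofReal_one_sub_le_measure_mean_le hn hδ0 hδ1 hLm
      (hindep.comp (fun _ => ℓ) fun _ => hℓm) (b := 4 * (1 + D) ^ 2) (by positivity)
      (fun i => (hid i).symm.ae_mem_snd measurableSet_Icc hℓb) fun i => (hid i).integral_eq
    refine ⟨_, ?_, hprob, fun w hw => ?_⟩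
    · exact measurableSet_le ((Finset.measurable_fun_sum _ fun i _ => hLm i).const_mul _)
        measurable_const
    · have hw' : empLoss (fun i => Xs i w) (fun i => Ys i w) h ≤ ∫ w, ℓ (X w, Y w) ∂P
          + 4 * (1 + D) ^ 2 / 2 * √(2 * Real.log (1 / δ) / n) := hw
      have hnonneg : 0 ≤ 8 * D / √(k : ℝ) := by positivity
      have := mmseEmp_le_empLoss hh (fun i => Xs i w) (fun i => Ys i w)
      rw [epsErr]
      linarith
  set C := NNMMSE.barronConst B η with hC
  have hlim : Tendsto (fun j : ℕ => C + 1 / ((j : ℝ) + 1)) atTop (𝓝 C) := by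
    simpa using tendsto_one_div_add_atTop_nhds_zero_nat.const_add C
  choose A hAm hAP hA using fun j : ℕ =>
    key (C + 1 / ((j : ℝ) + 1)) (lt_add_of_pos_right _ Nat.one_div_pos_of_nat)
  refine ⟨limsup A atTop, MeasurableSet.measurableSet_limsup hAm,
    NNMMSE.le_measure_limsup_of_le hAm hAP, fun w hw => ?_⟩
  rw [Filter.mem_limsup_iff_frequently_mem] at hw
  rw [sub_le_iff_le_add]
  exact ge_of_tendsto_of_frequently
    ((((NNMMSE.continuous_epsErr k n δ).tendsto C).comp hlim).const_add _)
    (hw.mono fun j hj => hA j w hj)
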